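/- Let $\mathbb P$ be a forcing notion (a nonempty preordered set; $q\le p$ means that $q$ is stronger than $p$). Say that $\mathbb P$ has the *Laver property* if for every ground-model function $f\in\omega^\omega\cap V$ and every $\mathbb P$-name $\dot g$ with $\Vdash \dot g\in\omega^\omega$ and $\Vdash\dot g\le^* f$, in every $\mathbb P$-generic extension $V[G]$ there is $\varphi\in([\omega]^{<\omega})^\omega\cap V$ such that $|\varphi(n)|\le n+1$ and $\dot g[G](n)\in\varphi(n)$ for all $n\in\omega$. (Equivalently, in terms of conditions: for all such $f,\dot g$ and every $p\in\mathbb P$ there are $q\le p$ and $\varphi\in V$ with $|\varphi(n)|\leq n+1$ for all $n$ and $q\Vdash\forall n\;\dot g(n)\in\varphi(n)$.) Let $\mathcal E$ be the ideal of subsets of $2^\omega$ generated by the $F_\sigma$ sets of Lebesgue measure zero. For a closed set $C\subseteq 2^\omega$ in $V$ with tree $T_C=\{y{\upharpoonright}n: y\in C,\,n\in\omega\}$, let $C^{V[G]}$ be the set of branches of $T_C$ in $V[G]$; for an $F_\sigma$ null set $A=\bigcup_n C_n$ coded in $V$ by closed null sets $C_n$, let $A^{V[G]}=\bigcup_n C_n^{V[G]}$.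 **Theorem.** Assume that $\mathbb P$ has the Laver property. Then $\mathbb P$ preserves covering families of $\mathcal E$ in the following sense. 1. The $F_\sigma$ null sets coded in the ground model cover the reals of every generic extension: in every $\mathbb P$-generic extension $V[G]$, for every $x\in 2^\omega$ there is an $F_\sigma$ null set $A$ coded in $V$ with $x\in A^{V[G]}$ (hence a closed null set $C\in V$ with $x\in C^{V[G]}$). 2. More generally, let $\mathcal F\in V$ be a family of (codes of) $F_\sigma$ null sets that generates $\mathcal E$ in $V$, in the sense that every member of $\mathcal E$ is covered by countably many members of $\mathcal F$ (for instance, a cofinal subfamily of $\mathcal E$). Then in every $\mathbb P$-generic extension $V[G]$ we have $2^\omega=\bigcup_{A\in\mathcal F}A^{V[G]}$. -/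

import Mathlib

universe u

/-
Forcing over the universe `V` of sets of Lean's type theory (`V` is `PSet.{u}`, well-founded
trees of type-`u` families up to extensional equality).
A forcing notion is a nonempty preorder `P : Type u`; `q ≤ p` means that `q` is stronger than `p`.
-/
namespace Forcing

/-! ### Names and the forcing relation for atomic formulas -/

/-- `P`-names: a name is a set of pairs `(τ i, c i)` of a name and a condition. -/
inductive PName (P : Type u) : Type (u + 1)
  | mk (ι : Type u) (cond : ι → P) (name : ι → PName P) : PName P

/-- The canonical name `x̌` of a ground model set: `x̌ = {(y̌, p) : y ∈ x, p ∈ P}`. -/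
def check (P : Type u) : PSet.{u} → PName P
  | PSet.mk α A => PName.mk (α × P) Prod.snd (fun i => check P (A i.1))

section Relation

variable {P : Type u} [Preorder P]

/-- `forcesEq σ τ p` is `p ⊩ σ = τ`, by recursion on names: for every `(σ', c) ∈ σ` and every
`q ≤ p` with `q ≤ c`, the set of conditions `s` such that `s ≤ d` and `s ⊩ σ' = τ'` for some
`(τ', d) ∈ τ` is dense below `q`; and the same with the roles of `σ` and `τ` exchanged. -/
def forcesEq : PName P → PName P → P → Prop
  | PName.mk ι c a, PName.mk κ d b => fun p =>
    (∀ i : ι, ∀ q ≤ p, q ≤ c i → ∀ r ≤ q, ∃ s ≤ r, ∃ j : κ, s ≤ d j ∧ forcesEq (a i) (b j) s) ∧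
    (∀ j : κ, ∀ q ≤ p, q ≤ d j → ∀ r ≤ q, ∃ s ≤ r, ∃ i : ι, s ≤ c i ∧ forcesEq (a i) (b j) s)

/-- `forcesMem σ τ p` is `p ⊩ σ ∈ τ`: the set of conditions `s` such that `s ≤ d` and
`s ⊩ σ = τ'` for some `(τ', d) ∈ τ` is dense below `p`. -/
def forcesMem (σ : PName P) : PName P → P → Prop
  | PName.mk κ d b => fun p => ∀ r ≤ p, ∃ s ≤ r, ∃ j : κ, s ≤ d j ∧ forcesEq σ (b j) s

/-! ### The forcing relation for compound formulas

A statement `φ` of the forcing language is represented by the predicate `p ↦ (p ⊩ φ)`; the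
clauses below are the usual recursive clauses of the forcing relation. -/

/-- A statement about the ground model only (so its truth value is decided outright). -/
def fGround (θ : Prop) : P → Prop := fun _ => θ

/-- Conjunction. -/
def fAnd (φ ψ : P → Prop) : P → Prop := fun p => φ p ∧ ψ p

/-- Implication: `p ⊩ φ → ψ` if every `q ≤ p` that forces `φ` forces `ψ`. -/
def fImp (φ ψ : P → Prop) : P → Prop := fun p => ∀ q ≤ p, φ q → ψ q

/-- Universal quantifier over a class `X` (all names, or the elements of a ground model set). -/
def fAll {X : Type*} (φ : X → P → Prop) : P → Prop := fun p => ∀ x, φ x p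

/-- Existential quantifier: `p ⊩ ∃ x, φ x` if the conditions forcing some instance `φ x` are
dense below `p`. -/
def fEx {X : Type*} (φ : X → P → Prop) : P → Prop := fun p => ∀ q ≤ p, ∃ r ≤ q, ∃ x, φ x r

/-- `⊩ φ`: every condition forces `φ`, that is, `φ` holds in every generic extension. -/
def Forced (φ : P → Prop) : Prop := ∀ p, φ p

/-! ### Names for reals -/

/-- The Kuratowski pair `(n, k) = {{n}, {n, k}}` of two von Neumann natural numbers. -/
def natPair (n k : ℕ) : PSet.{u} :=
  {{PSet.ofNat n}, {PSet.ofNat n, PSet.ofNat k}}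

/-- The statement `g(n) = k`, that is, `(n, k)ˇ ∈ g`. -/
def valueIs (g : PName P) (n k : ℕ) : P → Prop := forcesMem (check P (natPair n k)) g

/-- The statement `g ∈ ω^ω`: `g` is a set of pairs of natural numbers and a function defined
on all of `ω`. -/
def isBaireReal (g : PName P) : P → Prop :=
  fAnd (fAll fun σ : PName P => fImp (forcesMem σ g)
      (fEx fun nk : ℕ × ℕ => forcesEq σ (check P (natPair nk.1 nk.2))))
  (fAnd (fAll fun n : ℕ => fEx fun k : ℕ => valueIs g n k)
    (fAll fun n : ℕ => fAll fun k : ℕ => fAll fun l : ℕ =>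
      fImp (fAnd (valueIs g n k) (valueIs g n l)) (fGround (k = l))))

/-- The statement `x ∈ 2^ω`. -/
def isCantorReal (x : PName P) : P → Prop :=
  fAnd (isBaireReal x)
    (fAll fun n : ℕ => fAll fun k : ℕ => fImp (valueIs x n k) (fGround (k < 2)))

/-- The statement `g ≤* f` for a ground model function `f`: there is `m` such that
`g(n) ≤ f(n)` for all `n ≥ m`. -/
def isLeStar (g : PName P) (f : ℕ → ℕ) : P → Prop :=
  fEx fun m : ℕ => fAll fun n : ℕ => fAll fun k : ℕ =>
    fImp (valueIs g n k) (fGround (m ≤ n → k ≤ f n))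

end Relation

/-- The Laver property: whenever `g` is a name, `f : ω → ω` is in the ground model and
`⊩ g ∈ ω^ω ∧ g ≤* f`, then in every generic extension there is a ground model sequence `φ` of
finite sets with `|φ(n)| ≤ n + 1` and `g(n) ∈ φ(n)` for all `n`. -/
def LaverProperty (P : Type u) [Preorder P] : Prop :=
  ∀ (f : ℕ → ℕ) (g : PName P), Forced (isBaireReal g) → Forced (isLeStar g f) →
    Forced (fEx fun φ : {φ : ℕ → Finset ℕ // ∀ n, (φ n).card ≤ n + 1} =>
      fAll fun n : ℕ => fAll fun k : ℕ => fImp (valueIs g n k) (fGround (k ∈ φ.1 n) : P → Prop))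

/-! ### The ideal `𝓔` -/

/-- The Lebesgue measure on `2^ω`: the product of the fair coin measures. -/
noncomputable def cantorMeasure : MeasureTheory.Measure (ℕ → Bool) :=
  MeasureTheory.Measure.infinitePi fun _ : ℕ => (PMF.uniformOfFintype Bool).toMeasure

/-- Codes of `F_σ` null sets: sequences of closed null subsets of `2^ω`. -/
structure NullFsigma where
  seq : ℕ → Set (ℕ → Bool)
  isClosed : ∀ n, IsClosed (seq n)
  null : ∀ n, cantorMeasure (seq n) = 0

/-- The `F_σ` null set with a given code. -/
def NullFsigma.toSet (c : NullFsigma) : Set (ℕ → Bool) := ⋃ n, c.seq n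

/-- Membership in `𝓔`, the ideal on `2^ω` generated by the `F_σ` null sets (these are closed under
finite unions, so the ideal consists of their subsets). -/
def MemE (A : Set (ℕ → Bool)) : Prop := ∃ c : NullFsigma, A ⊆ c.toSet

/-- A family of `F_σ` null sets generates `𝓔` if every set in `𝓔` is covered by countably many
members of the family. Every cofinal family (base) of `𝓔` is of this kind. -/
def GeneratesE (F : Set NullFsigma) : Prop :=
  ∀ A, MemE A → ∃ c : ℕ → NullFsigma, (∀ n, c n ∈ F) ∧ A ⊆ ⋃ n, (c n).toSet

section Covering

variable {P : Type u} [Preorder P]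

/-- The statement `x ∈ C^{V[G]}` for a closed set `C ⊆ 2^ω` of the ground model, where `C^{V[G]}` is
the set of branches of the ground model tree `{y ↾ n : y ∈ C, n ∈ ω}`: for every `n` there is `y ∈ C`
in the ground model with `x ↾ n = y ↾ n`. -/
def memClosed (x : PName P) (C : Set (ℕ → Bool)) : P → Prop :=
  fAll fun n : ℕ => fEx fun y : C => fAll fun i : Fin n => valueIs x i (y.1 i).toNat

/-- The statement `x ∈ A^{V[G]}` for an `F_σ` null set `A` coded in the ground model. -/
def memFsigma (x : PName P) (c : NullFsigma) : P → Prop :=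
  fEx fun n : ℕ => memClosed x (c.seq n)

/-- In every generic extension by `P`, the reinterpretations of the members of the ground model
family `F` cover `2^ω`. -/
def ForcedCovering (P : Type u) [Preorder P] (F : Set NullFsigma) : Prop :=
  Forced (fAll fun x : PName P => fImp (isCantorReal x) (fEx fun c : F => memFsigma x c.1))

end Covering

end Forcing

/-! For a new real `x`, the code of `x ↾ n` takes at most `2 ^ n` values, so it is bounded by a
ground model function of `n`. The Laver property confines these codes to a slalom `φ` with at most
`n + 1` values at `n` (`LaverProperty.exists_slalom`). The branches through `φ` form a closed set,
null because `(n + 1) / 2 ^ n` tends to `0` (`cantorMeasure_slalomSet`), so countably many members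
of a generating family cover it in the ground model. That this covering still catches `x` in the
extension is an absoluteness fact, proved directly in `exists_memClosed`: a failure would yield a
ground model branch through `φ` outside all the covering sets. -/

namespace Forcing

/-! ### Ground model sets and their canonical names -/

theorem rank_ofNat (n : ℕ) : (PSet.ofNat.{u} n).rank = n := by
  induction n with
  | zero => simp [PSet.ofNat]
  | succ n ih => simp [PSet.ofNat, PSet.rank_insert, ih]

theorem mk_ofNat_injective :
    Function.Injective fun n : ℕ => ZFSet.mk (PSet.ofNat.{u} n) := by
  intro n m h
  have h := PSet.rank_congr (Quotient.exact h)
  simpa [rank_ofNat] using h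

theorem natPair_inj {n k m l : ℕ} (h : PSet.Equiv (natPair.{u} n k) (natPair.{u} m l)) :
    n = m ∧ k = l := by
  have h' : ZFSet.pair (ZFSet.mk (PSet.ofNat.{u} n)) (ZFSet.mk (PSet.ofNat k)) =
      ZFSet.pair (ZFSet.mk (PSet.ofNat m)) (ZFSet.mk (PSet.ofNat l)) :=
    show ZFSet.mk (natPair n k) = ZFSet.mk (natPair m l) from ZFSet.sound h
  obtain ⟨h₁, h₂⟩ := ZFSet.pair_injective h'
  exact ⟨mk_ofNat_injective h₁, mk_ofNat_injective h₂⟩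

section Names

variable {P : Type u} [Preorder P]

theorem forcesEq_refl (σ : PName P) (p : P) : forcesEq σ σ p := by
  induction σ generalizing p with
  | mk ι c a ih =>
    rw [forcesEq]
    exact ⟨fun i q _ hqi r hr => ⟨r, le_rfl, i, hr.trans hqi, ih i r⟩,
      fun i q _ hqi r hr => ⟨r, le_rfl, i, hr.trans hqi, ih i r⟩⟩

/-- If some condition forces two canonical names to be equal, the sets they name are equal. -/
theorem equiv_of_forcesEq_check {a b : PSet.{u}} {p : P}
    (h : forcesEq (check P a) (check P b) p) : PSet.Equiv a b := by
  induction a generalizing b p with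
  | mk α A ih =>
    obtain ⟨β, B⟩ := b
    simp only [check, forcesEq] at h
    refine ⟨fun i => ?_, fun j => ?_⟩
    -- A canonical name tags each element with every condition, so the tag can be taken to be `p`
    -- itself.
    · obtain ⟨s, -, j, -, hs⟩ := h.1 (i, p) p le_rfl le_rfl p le_rfl
      exact ⟨j.1, ih i hs⟩
    · obtain ⟨s, -, i, -, hs⟩ := h.2 (j, p) p le_rfl le_rfl p le_rfl
      exact ⟨i.1, ih i.1 hs⟩

theorem forcesMem_mono {σ τ : PName P} {p q : P} (hqp : q ≤ p) (h : forcesMem σ τ p) :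
    forcesMem σ τ q := by
  cases τ
  exact fun r hr => h r (hr.trans hqp)

theorem valueIs_mono {g : PName P} {n k : ℕ} {p q : P} (hqp : q ≤ p) (h : valueIs g n k p) :
    valueIs g n k q :=
  forcesMem_mono hqp h

/-- The name `{((n, k)ˇ, q) : ψ n k q}`. -/
def graphName (ψ : ℕ → ℕ → P → Prop) : PName P :=
  PName.mk {t : ℕ × ℕ × P // ψ t.1 t.2.1 t.2.2} (fun t => t.1.2.2)
    fun t => check P (natPair t.1.1 t.1.2.1)

variable {ψ : ℕ → ℕ → P → Prop}

theorem valueIs_graphName (hmono : ∀ n k p q, q ≤ p → ψ n k p → ψ n k q) {n k : ℕ} {p : P} :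
    valueIs (graphName ψ) n k p ↔ ∀ r ≤ p, ∃ s ≤ r, ψ n k s := by
  refine forall₂_congr fun r _ => ⟨?_, ?_⟩
  · rintro ⟨s, hs, ⟨⟨m, l, q⟩, hq⟩, hsq, he⟩
    obtain ⟨rfl, rfl⟩ := natPair_inj (equiv_of_forcesEq_check he)
    exact ⟨s, hs, hmono _ _ _ _ hsq hq⟩
  · rintro ⟨s, hs, h⟩
    exact ⟨s, hs, ⟨(n, k, s), h⟩, le_rfl, forcesEq_refl _ _⟩

theorem isBaireReal_graphName (hmono : ∀ n k p q, q ≤ p → ψ n k p → ψ n k q)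
    (hdense : ∀ n p, ∃ q ≤ p, ∃ k, ψ n k q)
    (huniq : ∀ n k l p, ψ n k p → ψ n l p → k = l) : Forced (isBaireReal (graphName ψ)) := by
  refine fun p => ⟨fun σ q _ hσ r hr => ?_, fun n q _ => ?_, fun n k l q _ h => ?_⟩
  · obtain ⟨s, hs, t, -, he⟩ := hσ r hr
    exact ⟨s, hs, (t.1.1, t.1.2.1), he⟩
  · obtain ⟨r, hr, k, hk⟩ := hdense n q
    exact ⟨r, hr, k, (valueIs_graphName hmono).2 fun s hs => ⟨s, le_rfl, hmono _ _ _ _ hs hk⟩⟩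
  · obtain ⟨r, hr, hk⟩ := (valueIs_graphName hmono).1 h.1 q le_rfl
    obtain ⟨s, hs, hl⟩ := (valueIs_graphName hmono).1 h.2 r hr
    exact huniq n k l s (hmono _ _ _ _ hs hk) hl

theorem isLeStar_graphName (hmono : ∀ n k p q, q ≤ p → ψ n k p → ψ n k q) {f : ℕ → ℕ}
    (hf : ∀ n k p, ψ n k p → k ≤ f n) : Forced (isLeStar (graphName ψ) f) := by
  refine fun p q _ => ⟨q, le_rfl, 0, fun n k r _ h _ => ?_⟩
  obtain ⟨s, -, hs⟩ := (valueIs_graphName hmono).1 h r le_rfl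
  exact hf n k s hs

/-! ### Deciding initial segments of names for reals -/

/-- The condition `p` decides the restriction of `x` to `n` to be `s`. -/
def Decides (x : PName P) (n : ℕ) (s : Fin n → Bool) (p : P) : Prop :=
  ∀ i : Fin n, valueIs x i (s i).toNat p

theorem Decides.mono {x : PName P} {n : ℕ} {s : Fin n → Bool} {p q : P} (h : Decides x n s p)
    (hqp : q ≤ p) : Decides x n s q :=
  fun i => valueIs_mono hqp (h i)

theorem isCantorReal_valueIs_unique {x : PName P} {p q : P} (hx : isCantorReal x p) (hqp : q ≤ p)
    {n : ℕ} {b c : Bool} (hb : valueIs x n b.toNat q) (hc : valueIs x n c.toNat q) : b = c := by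
  have h : b.toNat = c.toNat := hx.1.2.2 n b.toNat c.toNat q hqp ⟨hb, hc⟩
  revert h
  cases b <;> cases c <;> simp

theorem exists_decides {x : PName P} {p : P} (hx : isCantorReal x p) (n : ℕ) {q : P}
    (hqp : q ≤ p) : ∃ r ≤ q, ∃ s, Decides x n s r := by
  induction n with
  | zero => exact ⟨q, le_rfl, Fin.elim0, fun i => i.elim0⟩
  | succ n ih =>
    obtain ⟨r, hr, s, hs⟩ := ih
    obtain ⟨t, ht, k, hk⟩ := hx.1.2.1 n r (hr.trans hqp)
    have hk2 : k < 2 := hx.2 n k t (ht.trans (hr.trans hqp)) hk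
    obtain ⟨b, rfl⟩ : ∃ b : Bool, b.toNat = k := by
      interval_cases k
      exacts [⟨false, rfl⟩, ⟨true, rfl⟩]
    refine ⟨t, ht.trans hr, Fin.snoc (α := fun _ => Bool) s b, fun i => ?_⟩
    induction i using Fin.lastCases with
    | last => simpa using hk
    | cast i => simpa using hs.mono ht i

/-- The Laver property, applied to the sequence of initial segments of a real. -/
theorem LaverProperty.exists_slalom (hP : LaverProperty P) {x : PName P} {p : P}
    (hx : isCantorReal x p) : ∃ q ≤ p, ∃ φ : ℕ → Finset ℕ, (∀ n, (φ n).card ≤ n + 1) ∧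
      ∀ n s, ∀ r ≤ q, Decides x n s r → Encodable.encode s ∈ φ n := by
  -- The Laver property needs a name that every condition forces to be a real, while `x` is assumed
  -- to be one only below `p`. Conditions incompatible with `p` therefore assign the default value
  -- `0`.
  let ψ : ℕ → ℕ → P → Prop := fun n k q =>
    (q ≤ p ∧ ∃ s, Encodable.encode s = k ∧ Decides x n s q) ∨ (k = 0 ∧ ∀ r ≤ q, ¬ r ≤ p)
  have hmono : ∀ n k p q, q ≤ p → ψ n k p → ψ n k q := by
    rintro n k q r hrq (⟨hq, s, hk, hs⟩ | ⟨hk, hq⟩)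
    · exact Or.inl ⟨hrq.trans hq, s, hk, hs.mono hrq⟩
    · exact Or.inr ⟨hk, fun t ht => hq t (ht.trans hrq)⟩
  have hdense : ∀ n p, ∃ q ≤ p, ∃ k, ψ n k q := by
    intro n q
    by_cases h : ∃ r ≤ q, r ≤ p
    · obtain ⟨r, hrq, hrp⟩ := h
      obtain ⟨t, ht, s, hs⟩ := exists_decides hx n hrp
      exact ⟨t, ht.trans hrq, _, Or.inl ⟨ht.trans hrp, s, rfl, hs⟩⟩
    · push Not at h
      exact ⟨q, le_rfl, 0, Or.inr ⟨rfl, h⟩⟩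
  have huniq : ∀ n k l p, ψ n k p → ψ n l p → k = l := by
    rintro n k l q (⟨hq, s, rfl, hs⟩ | ⟨rfl, hq⟩) (⟨hq', t, rfl, ht⟩ | ⟨rfl, hq'⟩)
    · congr 1
      funext i
      exact isCantorReal_valueIs_unique hx hq (hs i) (ht i)
    · exact absurd hq (hq' q le_rfl)
    · exact absurd hq' (hq q le_rfl)
    · rfl
  -- The ground model bound is the largest code of a string of length `n`.
  have hle : ∀ n k p, ψ n k p →
      k ≤ Finset.univ.sup fun s : Fin n → Bool => Encodable.encode s := by
    rintro n k q (⟨-, s, rfl, -⟩ | ⟨rfl, -⟩)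
    · exact Finset.le_sup (f := fun s : Fin n → Bool => Encodable.encode s) (Finset.mem_univ s)
    · exact Nat.zero_le _
  obtain ⟨q, hq, φ, hφ⟩ := hP _ _ (isBaireReal_graphName hmono hdense huniq)
    (isLeStar_graphName hmono hle) p p le_rfl
  refine ⟨q, hq, φ.1, φ.2, fun n s r hr hs => hφ n _ r hr ?_⟩
  exact (valueIs_graphName hmono).2 fun t ht =>
    ⟨t, le_rfl, Or.inl ⟨ht.trans (hr.trans hq), s, rfl, hs.mono ht⟩⟩

/-- If a ground model set `C` covered by the sets `D k` contains every real of the ground model all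
of whose initial segments are possible for `x` below `q`, then some condition below `q` forces `x`
into the reinterpretation of some `D k`. -/
theorem exists_memClosed {x : PName P} {p q : P} (hx : isCantorReal x p) (hqp : q ≤ p)
    {C : Set (ℕ → Bool)} {D : ℕ → Set (ℕ → Bool)} (hCD : C ⊆ ⋃ k, D k)
    (hC : ∀ y : ℕ → Bool, (∀ n, ∃ r ≤ q, Decides x n (fun i => y i) r) → y ∈ C) :
    ∃ r ≤ q, ∃ k, memClosed x (D k) r := by
  by_contra! hcon
  have step : ∀ (k : ℕ) (r : {r // r ≤ q}), ∃ t : {r // r ≤ q}, t.1 ≤ r.1 ∧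
      ∃ n, k < n ∧ ∃ s : Fin n → Bool, Decides x n s t.1 ∧ ∀ y ∈ D k, ∃ i : Fin n, y i ≠ s i := by
    rintro k ⟨r, hr⟩
    have h := hcon r hr k
    simp only [memClosed, fAll, fEx, not_forall, not_exists, not_and] at h
    obtain ⟨n, t, htr, ht⟩ := h
    -- The length exceeds `k`, so that step `k` decides digit `k`, and is at least `n`, so that `s`
    -- covers the segment on which `t` excludes `D k`.
    obtain ⟨u, hut, s, hs⟩ := exists_decides hx (n + k + 1) (htr.trans (hr.trans hqp))
    refine ⟨⟨u, hut.trans (htr.trans hr)⟩, hut.trans htr, n + k + 1, by omega, s, hs, ?_⟩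
    intro y hy
    obtain ⟨i, hi⟩ := ht u hut ⟨y, hy⟩
    refine ⟨⟨i, by omega⟩, fun he => hi ?_⟩
    have := hs ⟨i, by omega⟩
    rwa [← he] at this
  choose next hnext N hN s hs hD using step
  let c : ℕ → {r // r ≤ q} := fun k => Nat.rec ⟨q, le_rfl⟩ next k
  have hc : Antitone fun k => (c k).1 := antitone_nat_of_succ_le fun k => hnext k (c k)
  let y : ℕ → Bool := fun i => s i (c i) ⟨i, hN i (c i)⟩
  have hy : ∀ i, valueIs x i (y i).toNat (c (i + 1)).1 := fun i => hs i (c i) ⟨i, hN i (c i)⟩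
  have hyC : y ∈ C := hC y fun n =>
    ⟨(c n).1, (c n).2, fun i => valueIs_mono (hc i.2) (hy i)⟩
  obtain ⟨k, hk⟩ := Set.mem_iUnion.1 (hCD hyC)
  obtain ⟨i, hi⟩ := hD k (c k) y hk
  -- Digit `i` of `y` and the string of step `k` are decided at different stages; they are compared
  -- at a common later one.
  refine hi (isCantorReal_valueIs_unique hx ((c (max (i + 1) (k + 1))).2.trans hqp)
    (valueIs_mono (hc (le_max_left _ _)) (hy i)) ?_)
  exact valueIs_mono (hc (le_max_right _ _)) (hs k (c k) i)

end Names

/-! ### Closed null sets from slaloms -/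

theorem cantorMeasure_cylinder {n : ℕ} (s : Fin n → Bool) :
    cantorMeasure {y | (fun i : Fin n => y i) = s} = (2⁻¹ : ENNReal) ^ n := by
  have hset : {y : ℕ → Bool | (fun i : Fin n => y i) = s} =
      Set.pi (Finset.range n) fun i => {if h : i < n then s ⟨i, h⟩ else false} := by
    ext y
    simp only [Set.mem_ofPred_eq, funext_iff, Set.mem_pi, Finset.coe_range, Set.mem_Iio,
      Set.mem_singleton_iff]
    refine ⟨fun h i hi => by rw [dif_pos hi]; exact h ⟨i, hi⟩, fun h i => ?_⟩
    rw [h i i.2, dif_pos i.2]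
  rw [hset, cantorMeasure, MeasureTheory.Measure.infinitePi_pi]
  · have h : ∀ b : Bool, (PMF.uniformOfFintype Bool).toMeasure {b} = 2⁻¹ := fun b => by
      rw [PMF.toMeasure_apply_singleton _ _ (MeasurableSet.singleton b)]
      simp
    rw [Finset.prod_congr rfl fun i _ => h _, Finset.prod_const, Finset.card_range]
  · exact fun i _ => MeasurableSet.singleton _

/-- The set of branches `y` with `y ↾ n ∈ φ n` for all `n`. -/
def slalomSet (φ : ℕ → Finset ℕ) : Set (ℕ → Bool) :=
  {y | ∀ n, Encodable.encode (fun i : Fin n => y i) ∈ φ n}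

theorem isClosed_slalomSet (φ : ℕ → Finset ℕ) : IsClosed (slalomSet φ) := by
  rw [slalomSet, Set.ofPred_forall]
  refine isClosed_iInter fun n => ?_
  have hcont : Continuous fun (y : ℕ → Bool) (i : Fin n) => y i :=
    continuous_pi fun i => continuous_apply (i : ℕ)
  exact (isClosed_discrete {s : Fin n → Bool | Encodable.encode s ∈ φ n}).preimage hcont

theorem cantorMeasure_slalomSet {φ : ℕ → Finset ℕ} (hφ : ∀ n, (φ n).card ≤ n + 1) :
    cantorMeasure (slalomSet φ) = 0 := by
  have hle : ∀ n : ℕ, cantorMeasure (slalomSet φ) ≤ ((n + 1 : ℕ) : ENNReal) * 2⁻¹ ^ n := by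
    intro n
    let S : Finset (Fin n → Bool) := Finset.univ.filter fun s => Encodable.encode s ∈ φ n
    have hS : S.card ≤ n + 1 := by
      refine (Finset.card_le_card_of_injOn Encodable.encode (fun s hs => ?_)
        (Encodable.encode_injective.injOn)).trans (hφ n)
      exact (Finset.mem_filter.1 hs).2
    calc cantorMeasure (slalomSet φ)
        ≤ cantorMeasure (⋃ s ∈ S, {y | (fun i : Fin n => y i) = s}) := by
          refine MeasureTheory.measure_mono fun y hy => ?_
          simp only [Set.mem_iUnion]
          exact ⟨fun i => y i, Finset.mem_filter.2 ⟨Finset.mem_univ _, hy n⟩, rfl⟩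
      _ ≤ ∑ s ∈ S, cantorMeasure {y | (fun i : Fin n => y i) = s} :=
          MeasureTheory.measure_biUnion_finset_le _ _
      _ = S.card * 2⁻¹ ^ n := by simp [cantorMeasure_cylinder]
      _ ≤ _ := by gcongr
  have hlim : Filter.Tendsto (fun n : ℕ => ((n + 1 : ℕ) : ENNReal) * 2⁻¹ ^ n) Filter.atTop
      (nhds 0) := by
    have h₁ := tendsto_self_mul_const_pow_of_lt_one (r := (2⁻¹ : ℝ)) (by norm_num) (by norm_num)
    have h₂ := tendsto_pow_atTop_nhds_zero_of_lt_one (r := (2⁻¹ : ℝ)) (by norm_num) (by norm_num)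
    have h := ENNReal.tendsto_ofReal (h₁.add h₂)
    rw [add_zero, ENNReal.ofReal_zero] at h
    refine h.congr fun n => ?_
    rw [← add_one_mul, ENNReal.ofReal_mul (by positivity), ENNReal.ofReal_pow (by norm_num),
      ENNReal.ofReal_inv_of_pos (by norm_num)]
    norm_num [ENNReal.ofReal_add]
  exact le_antisymm (ge_of_tendsto' hlim hle) zero_le

theorem memE_slalomSet {φ : ℕ → Finset ℕ} (hφ : ∀ n, (φ n).card ≤ n + 1) :
    MemE (slalomSet φ) :=
  ⟨⟨fun _ => slalomSet φ, fun _ => isClosed_slalomSet φ, fun _ => cantorMeasure_slalomSet hφ⟩,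
    Set.subset_iUnion (fun _ : ℕ => slalomSet φ) 0⟩

/-! ### The covering theorem -/

theorem generatesE_univ : GeneratesE Set.univ :=
  fun _ ⟨c, hc⟩ => ⟨fun _ => c, fun _ => Set.mem_univ _,
    hc.trans (Set.subset_iUnion (fun _ : ℕ => c.toSet) 0)⟩

theorem LaverProperty.forcedCovering {P : Type u} [Preorder P] (hP : LaverProperty P)
    {F : Set NullFsigma} (hF : GeneratesE F) : ForcedCovering P F := by
  intro _ x p _ hx p' hp'
  have hx' : ∀ q ≤ p, isCantorReal x q := fun q hq =>
    ⟨⟨fun σ r hr => hx.1.1 σ r (hr.trans hq), fun n r hr => hx.1.2.1 n r (hr.trans hq),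
      fun n k l r hr => hx.1.2.2 n k l r (hr.trans hq)⟩,
      fun n k r hr => hx.2 n k r (hr.trans hq)⟩
  obtain ⟨q, hq, φ, hφ, hdec⟩ := hP.exists_slalom (hx' p' hp')
  obtain ⟨c, hcF, hc⟩ := hF _ (memE_slalomSet hφ)
  obtain ⟨r, hr, k, hk⟩ := exists_memClosed (hx' p' hp') hq
    -- Pairing lists all closed pieces of all the sets `c n` in one sequence.
    (D := fun k => (c k.unpair.1).seq k.unpair.2) (C := slalomSet φ) (fun y hy => by
      obtain ⟨n, hn⟩ := Set.mem_iUnion.1 (hc hy)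
      obtain ⟨m, hm⟩ := Set.mem_iUnion.1 hn
      exact Set.mem_iUnion.2 ⟨Nat.pair n m, by simpa using hm⟩)
    (fun y hy n => by
      obtain ⟨r, hr, hs⟩ := hy n
      exact hdec n _ r hr hs)
  refine ⟨r, hr.trans hq, ⟨c k.unpair.1, hcF _⟩, fun t ht => ⟨t, le_rfl, k.unpair.2, ?_⟩⟩
  exact fun n u hu => hk n u (hu.trans ht)

end Forcing

theorem mainTheorem7 {P : Type*} [Preorder P] [Nonempty P] (hP : Forcing.LaverProperty P) :
    Forcing.ForcedCovering P Set.univ ∧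
      ∀ F : Set Forcing.NullFsigma, Forcing.GeneratesE F → Forcing.ForcedCovering P F :=
  ⟨hP.forcedCovering Forcing.generatesE_univ, fun _ hF => hP.forcedCovering hF⟩
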